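/- For $1<q<\infty$ let $d(q)$ be the space of all bounded complex sequences $x=(x_n)_{n}$ such that $\hat x:=(\sup_{k\ge n}|x_k|)_n\in\ell_q$, with the norm $\|x\|_{d(q)}:=\|\hat x\|_{\ell_q}$. For $1<p\le\infty$ let $d(p-):=\bigcup_{1<q<p}d(q)$, equipped with the locally convex inductive limit topology, i.e. the finest locally convex vector space topology for which all inclusions $d(q)\subseteq d(p-)$, $1<q<p$, are continuous; let $\mathbb C^{\mathbb N}$ carry the topology of coordinatewise convergence. A (DFS)-space is a space which is topologically isomorphic to the strong dual of a Fréchet–Schwartz space, and a Montel space is a barrelled locally convex Hausdorff space in which every closed bounded set is compact. (i) Let $1<p\le\infty$. Then $d(p-)$ is an (LB)-space: each $d(q)$ with $1<q<p$ is a Banach space and, for every strictly increasing sequence $(p_k)_k$ in $(1,p)$ with $p_k\to p$, we have $d(p-)=\bigcup_k d(p_k)$ and $d(p-)=\operatorname{ind}_k d(p_k)$ topologically. Moreover, $d(p-)$ is a (DFS)-space and a Montel space. (ii) Let $1<p\le q\le\infty$. Then $d(p-)\subseteq d(q-)\subseteq\mathbb C^{\mathbb N}$, with both inclusions continuous. If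 in addition $p<q$, then $d(p-)\subsetneqq d(q-)$. -/

import Mathlib

open scoped ENNReal Topology

noncomputable section

/-! ### Locally convex notions -/

section LocallyConvex

/-- The locally convex inductive limit topology: the finest locally convex vector space topology
on `F` for which all the linear maps `j i : E i → F` are continuous. (In Mathlib's order on
topologies, finer means smaller.) -/
abbrev inductiveLimitTopology {ι : Type*} {E : ι → Type*} {F : Type*}
    [∀ i, AddCommGroup (E i)] [∀ i, Module ℂ (E i)] [∀ i, TopologicalSpace (E i)]
    [AddCommGroup F] [Module ℂ F] (j : ∀ i, E i →ₗ[ℂ] F) : TopologicalSpace F :=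
  sInf {t : TopologicalSpace F | @IsTopologicalAddGroup F t _ ∧ @ContinuousSMul ℂ F _ _ t ∧
    @LocallyConvexSpace ℝ F _ _ _ _ t ∧ ∀ i, @Continuous (E i) F _ t (j i)}

/-- The inductive limit topology belongs to the family of topologies of which it is the
infimum. -/
theorem inductiveLimitTopology_spec {ι : Type*} {E : ι → Type*} {F : Type*}
    [∀ i, AddCommGroup (E i)] [∀ i, Module ℂ (E i)] [∀ i, TopologicalSpace (E i)]
    [AddCommGroup F] [Module ℂ F] (j : ∀ i, E i →ₗ[ℂ] F) :
    @IsTopologicalAddGroup F (inductiveLimitTopology j) _ ∧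
    @ContinuousSMul ℂ F _ _ (inductiveLimitTopology j) ∧
    @LocallyConvexSpace ℝ F _ _ _ _ (inductiveLimitTopology j) ∧
    ∀ i, @Continuous (E i) F _ (inductiveLimitTopology j) (j i) := by
  refine ⟨topologicalAddGroup_sInf fun t ht => ht.1, continuousSMul_sInf fun t ht => ht.2.1,
    LocallyConvexSpace.sInf fun t ht => ?_, fun i => continuous_sInf_rng.2 fun t ht => ht.2.2.2 i⟩
  exact ht.2.2.1

/-- Fréchet spaces over `ℂ`: complete metrizable (that is, Hausdorff with countably generated
uniformity) locally convex topological vector spaces. -/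
structure IsFrechetSpace (F : Type*) [AddCommGroup F] [Module ℂ F] [UniformSpace F] : Prop where
  isUniformAddGroup : IsUniformAddGroup F
  continuousSMul : ContinuousSMul ℂ F
  locallyConvexSpace : LocallyConvexSpace ℝ F
  t2Space : T2Space F
  isCountablyGenerated : (uniformity F).IsCountablyGenerated
  completeSpace : CompleteSpace F

/-- The Schwartz property: for each zero neighbourhood `U` there is a zero neighbourhood `V` which,
for every `ε > 0`, is covered by finitely many translates of `ε U`. -/
def HasSchwartzProperty (F : Type*) [AddCommGroup F] [Module ℂ F] [TopologicalSpace F] : Prop :=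
  ∀ U ∈ 𝓝 (0 : F), ∃ V ∈ 𝓝 (0 : F), ∀ ε : ℝ, 0 < ε →
    ∃ s : Set F, s.Finite ∧ ∀ v ∈ V, ∃ x ∈ s, ∃ u ∈ U, v = x + ε • u

universe u in
/-- (DFS)-spaces: spaces that are topologically isomorphic to the strong dual of some
Fréchet-Schwartz space. The topology on `StrongDual ℂ F` is that of uniform convergence on the
bounded subsets of `F`. -/
def IsDFSSpace (E : Type u) [AddCommGroup E] [Module ℂ E] [TopologicalSpace E] : Prop :=
  ∃ (F : Type u) (_ : AddCommGroup F) (_ : Module ℂ F) (_ : UniformSpace F),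
    IsFrechetSpace F ∧ HasSchwartzProperty F ∧ Nonempty (E ≃L[ℂ] StrongDual ℂ F)

/-- Montel spaces in the usual sense: barrelled Hausdorff locally convex spaces in which closed
bounded sets are compact. (Mathlib's `MontelSpace` is the last property only.) -/
structure IsMontelSpace (E : Type*) [AddCommGroup E] [Module ℂ E] [TopologicalSpace E] :
    Prop where
  isTopologicalAddGroup : IsTopologicalAddGroup E
  continuousSMul : ContinuousSMul ℂ E
  locallyConvexSpace : LocallyConvexSpace ℝ E
  t2Space : T2Space E
  barrelledSpace : BarrelledSpace ℂ E
  montelSpace : MontelSpace ℂ E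

end LocallyConvex

/-! ### The Banach spaces `d(q)` -/

section DSpace

/-- `x̂ n = sup_{k ≥ n} |x k|`. -/
def tailSup (x : ℕ → ℂ) (n : ℕ) : ℝ := ⨆ k : ℕ, ‖x (n + k)‖

theorem tailSup_nonneg (x : ℕ → ℂ) (n : ℕ) : 0 ≤ tailSup x n :=
  Real.iSup_nonneg fun _ => norm_nonneg _

theorem bddAbove_tail {x : ℕ → ℂ} (hx : Memℓp x ∞) (n : ℕ) :
    BddAbove (Set.range fun k : ℕ => ‖x (n + k)‖) :=
  hx.bddAbove.mono (by rintro _ ⟨k, rfl⟩; exact ⟨n + k, rfl⟩)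

theorem norm_le_tailSup {x : ℕ → ℂ} (hx : Memℓp x ∞) (n : ℕ) : ‖x n‖ ≤ tailSup x n :=
  le_ciSup (bddAbove_tail hx n) 0

theorem tailSup_zero : tailSup 0 = 0 := by
  funext n
  simp [tailSup]

theorem tailSup_add_le {x y : ℕ → ℂ} (hx : Memℓp x ∞) (hy : Memℓp y ∞) (n : ℕ) :
    tailSup (x + y) n ≤ tailSup x n + tailSup y n :=
  ciSup_le fun k => (norm_add_le _ _).trans
    (add_le_add (le_ciSup (bddAbove_tail hx n) k) (le_ciSup (bddAbove_tail hy n) k))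

theorem tailSup_smul (c : ℂ) (x : ℕ → ℂ) : tailSup (c • x) = ‖c‖ • tailSup x := by
  funext n
  simp [tailSup, Real.mul_iSup_of_nonneg]

/-- The underlying vector space of `d(q)`: bounded complex sequences `x` with `x̂ ∈ ℓ_q`. -/
def dSubmodule (q : ℝ≥0∞) : Submodule ℂ (ℕ → ℂ) where
  carrier := {x | Memℓp x ∞ ∧ Memℓp (tailSup x) q}
  zero_mem' := ⟨zero_memℓp, by rw [tailSup_zero]; exact zero_memℓp⟩
  add_mem' {x y} hx hy := ⟨hx.1.add hy.1, (hx.2.add hy.2).mono' fun n => by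
    rw [Pi.add_apply, Real.norm_of_nonneg (tailSup_nonneg _ _), Real.norm_of_nonneg
      (add_nonneg (tailSup_nonneg _ _) (tailSup_nonneg _ _))]
    exact tailSup_add_le hx.1 hy.1 n⟩
  smul_mem' c x hx := ⟨hx.1.const_smul c, by rw [tailSup_smul]; exact hx.2.const_smul ‖c‖⟩

theorem dSubmodule_mono {q r : ℝ≥0∞} (h : q ≤ r) : dSubmodule q ≤ dSubmodule r :=
  fun _ hx => ⟨hx.1, hx.2.of_exponent_ge h⟩

/-- The space `d(q)` as a type of its own, so that it can carry its norm topology rather than the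
topology induced from `ℕ → ℂ`. -/
def DSpace (q : ℝ≥0∞) : Type := dSubmodule q

namespace DSpace

variable {q : ℝ≥0∞}

instance : AddCommGroup (DSpace q) := inferInstanceAs (AddCommGroup (dSubmodule q))

instance : Module ℂ (DSpace q) := inferInstanceAs (Module ℂ (dSubmodule q))

/-- The sequence underlying an element of `d(q)`. -/
def toSeq : DSpace q →ₗ[ℂ] (ℕ → ℂ) := (dSubmodule q).subtype

theorem toSeq_mem (x : DSpace q) : toSeq x ∈ dSubmodule q := Subtype.property x

/-- `x̂` as an element of `ℓ_q`. -/
def hat (x : DSpace q) : lp (fun _ : ℕ => ℝ) q := ⟨tailSup (toSeq x), (toSeq_mem x).2⟩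

/-- The norm `‖x‖ = ‖x̂‖_q` of `d(q)`. -/
instance : Norm (DSpace q) := ⟨fun x => ‖hat x‖⟩

theorem norm_def (x : DSpace q) : ‖x‖ = ‖hat x‖ := rfl

theorem normedSpaceCore [Fact (1 ≤ q)] : NormedSpace.Core ℂ (DSpace q) where
  norm_nonneg x := norm_nonneg (hat x)
  norm_smul c x := by
    have : hat (c • x) = ‖c‖ • hat x := by
      apply lp.ext
      change tailSup (toSeq (c • x)) = ‖c‖ • tailSup (toSeq x)
      rw [map_smul, tailSup_smul]
    rw [norm_def, this, norm_smul, norm_norm, norm_def]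
  norm_triangle x y := by
    refine le_trans ?_ (norm_add_le (hat x) (hat y))
    refine lp.norm_mono (zero_lt_one.trans_le Fact.out).ne' fun n => ?_
    change ‖tailSup (toSeq (x + y)) n‖ ≤ ‖tailSup (toSeq x) n + tailSup (toSeq y) n‖
    rw [Real.norm_of_nonneg (tailSup_nonneg _ _), Real.norm_of_nonneg
      (add_nonneg (tailSup_nonneg _ _) (tailSup_nonneg _ _)), map_add]
    exact tailSup_add_le (toSeq_mem x).1 (toSeq_mem y).1 n
  norm_eq_zero_iff x := by
    rw [norm_def, norm_eq_zero]
    constructor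
    · intro h
      apply Subtype.ext
      funext n
      have h1 : tailSup (toSeq x) n = 0 := congrFun (congrArg Subtype.val h) n
      exact norm_le_zero_iff.1 (h1 ▸ norm_le_tailSup (toSeq_mem x).1 n)
    · rintro rfl
      apply lp.ext
      change tailSup (toSeq 0) = 0
      rw [map_zero, tailSup_zero]

instance [Fact (1 ≤ q)] : NormedAddCommGroup (DSpace q) :=
  NormedAddCommGroup.ofCore normedSpaceCore

instance [Fact (1 ≤ q)] : NormedSpace ℂ (DSpace q) := NormedSpace.ofCore normedSpaceCore

end DSpace

end DSpace

/-! ### The (LB)-spaces `d(p-)` -/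

section DMinus

instance factOneLeOfMemIoo {p : ℝ≥0∞} (q : Set.Ioo 1 p) : Fact (1 ≤ (q : ℝ≥0∞)) := ⟨q.2.1.le⟩

variable (p : ℝ≥0∞) [Fact (1 < p)]

/-- The underlying vector space of `d(p-)`: the union of the `d(q)`, `1 < q < p`. -/
def dMinusSubmodule : Submodule ℂ (ℕ → ℂ) where
  carrier := ⋃ q ∈ Set.Ioo 1 p, (dSubmodule q : Set (ℕ → ℂ))
  zero_mem' := by
    obtain ⟨q, hq⟩ := exists_between (Fact.out : 1 < p)
    exact Set.mem_biUnion (show q ∈ Set.Ioo 1 p from hq) (dSubmodule q).zero_mem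
  add_mem' {x y} hx hy := by
    obtain ⟨q, hq, hx⟩ := Set.mem_iUnion₂.1 hx
    obtain ⟨r, hr, hy⟩ := Set.mem_iUnion₂.1 hy
    exact Set.mem_biUnion (show max q r ∈ Set.Ioo 1 p from ⟨lt_max_of_lt_left hq.1, max_lt hq.2 hr.2⟩)
      ((dSubmodule _).add_mem (dSubmodule_mono (le_max_left q r) hx)
        (dSubmodule_mono (le_max_right q r) hy))
  smul_mem' c x hx := by
    obtain ⟨q, hq, hx⟩ := Set.mem_iUnion₂.1 hx
    exact Set.mem_biUnion hq ((dSubmodule q).smul_mem c hx)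

theorem dSubmodule_le_dMinusSubmodule (q : Set.Ioo 1 p) :
    dSubmodule q ≤ dMinusSubmodule p :=
  fun _ hx => Set.mem_biUnion q.2 hx

/-- The space `d(p-)` as a type of its own, so that it can carry its inductive limit topology
rather than the topology induced from `ℕ → ℂ`. -/
def DMinus : Type := dMinusSubmodule p

namespace DMinus

instance : AddCommGroup (DMinus p) := inferInstanceAs (AddCommGroup (dMinusSubmodule p))

instance : Module ℂ (DMinus p) := inferInstanceAs (Module ℂ (dMinusSubmodule p))

/-- The inclusion `d(p-) ⊆ ℂ^ℕ`. -/
def toSeq : DMinus p →ₗ[ℂ] (ℕ → ℂ) := (dMinusSubmodule p).subtype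

/-- The inclusion `d(q) ⊆ d(p-)`, for `1 < q < p`. -/
def ofStep (q : Set.Ioo 1 p) : DSpace q →ₗ[ℂ] DMinus p :=
  Submodule.inclusion (dSubmodule_le_dMinusSubmodule p q)

/-- The topology of `d(p-) = ind_{1 < q < p} d(q)`. -/
instance topology : TopologicalSpace (DMinus p) := inductiveLimitTopology (ofStep p)

end DMinus

end DMinus

end

/-! Since `x̂` is decreasing, an element of `d(q)` satisfies `|x n| ≤ ‖x‖ (n + 1) ^ (-1/q)`
(`DSpace.norm_toSeq_le`); conversely, decay of order `a > 1/r` puts a sequence into `d(r)`. Hence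
`d(p-)` consists of the sequences that are `O((n + 1) ^ (-a))` for some `a > 1/p`
(`mem_dMinusSubmodule_iff`), that is, of a union of polydiscs. For `p = ∞` the expression
`p.toReal⁻¹` is `0`, the correct value of `1/p`.

Montel: polydiscs are compact in `ℂ^ℕ` by Tychonoff, and a little spare decay turns coordinatewise
convergence on them into norm convergence in some step (`continuous_mk_polydisc`), so they are
compact in `d(p-)`. Barrelledness is inherited from the complete steps and confines each bounded set
to a polydisc (`exists_subset_polydisc`).

(DFS): let `u k` decrease strictly to `1/p`. The predual is the Köthe echelon space of order one
with weights `(n + 1) ^ (-u k)`, which is Schwartz because quotients of consecutive weights tend to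
zero. The pairing `∑ x n * y n` identifies `d(p-)` with its dual algebraically; it is continuous on
every step, and its inverse is continuous by a bipolar argument (`continuous_symm_pairing`).

The independence of the sequence `p_k` is cofinality, and `(n + 1) ^ (-1/p)` separates `d(p-)` from
`d(q-)` for `p < q`. -/

noncomputable section

open Filter

/-! ### Universal property of the inductive limit topology -/

section InductiveLimit

variable {ι : Type*} {E : ι → Type*} {F G : Type*}
  [∀ i, AddCommGroup (E i)] [∀ i, Module ℂ (E i)] [∀ i, TopologicalSpace (E i)]
  [AddCommGroup F] [Module ℂ F]

theorem inductiveLimitTopology_le {j : ∀ i, E i →ₗ[ℂ] F} {t : TopologicalSpace F}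
    (h₁ : @IsTopologicalAddGroup F t _) (h₂ : @ContinuousSMul ℂ F _ _ t)
    (h₃ : @LocallyConvexSpace ℝ F _ _ _ _ t) (h₄ : ∀ i, @Continuous (E i) F _ t (j i)) :
    inductiveLimitTopology j ≤ t :=
  sInf_le ⟨h₁, h₂, h₃, h₄⟩

/-- The topology induced by `f` is itself one of the competitors in the infimum. -/
theorem continuous_inductiveLimitTopology_dom (j : ∀ i, E i →ₗ[ℂ] F)
    [AddCommGroup G] [Module ℂ G] [TopologicalSpace G] [IsTopologicalAddGroup G]
    [ContinuousSMul ℂ G] [LocallyConvexSpace ℝ G] (f : F →ₗ[ℂ] G)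
    (hf : ∀ i, Continuous (f ∘ j i)) :
    @Continuous F G (inductiveLimitTopology j) _ f := by
  rw [continuous_iff_le_induced]
  exact inductiveLimitTopology_le (topologicalAddGroup_induced f)
    (continuousSMul_induced f) (LocallyConvexSpace.induced (f.restrictScalars ℝ))
    fun i => continuous_induced_rng.2 (hf i)

/-- Here the competitor is the topology generated by the single seminorm `σ`. -/
theorem Seminorm.continuous_inductiveLimitTopology_dom (j : ∀ i, E i →ₗ[ℂ] F)
    [∀ i, IsTopologicalAddGroup (E i)] (σ : Seminorm ℂ F) (hσ : ∀ i, Continuous (σ ∘ j i)) :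
    @Continuous F ℝ (inductiveLimitTopology j) _ σ := by
  let P : SeminormFamily ℂ F Unit := fun _ => σ
  let t : TopologicalSpace F := P.moduleFilterBasis.topology
  have hP : WithSeminorms P := ⟨rfl⟩
  have hle : inductiveLimitTopology j ≤ t :=
    inductiveLimitTopology_le hP.topologicalAddGroup hP.continuousSMul hP.toLocallyConvexSpace
      fun i => hP.continuous_of_continuous_comp (j i) fun _ => hσ i
  exact continuous_le_dom hle (hP.continuous_seminorm ())

theorem barrelledSpace_inductiveLimitTopology (j : ∀ i, E i →ₗ[ℂ] F)
    [∀ i, IsTopologicalAddGroup (E i)] [∀ i, BarrelledSpace ℂ (E i)] :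
    @BarrelledSpace ℂ F _ _ _ (inductiveLimitTopology j) := by
  let _ := inductiveLimitTopology j
  refine ⟨fun σ hσ => σ.continuous_inductiveLimitTopology_dom j fun i => ?_⟩
  exact (σ.comp (j i)).continuous_of_lowerSemicontinuous
    (show LowerSemicontinuous (σ ∘ j i) from hσ.comp ((inductiveLimitTopology_spec j).2.2.2 i))

end InductiveLimit

/-! ### The steps `d(q)` -/

theorem antitone_tailSup {x : ℕ → ℂ} (hx : Memℓp x ∞) : Antitone (tailSup x) := by
  refine antitone_nat_of_succ_le fun n => ciSup_le fun k => ?_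
  have := le_ciSup (bddAbove_tail hx n) (1 + k)
  rwa [← add_assoc] at this

theorem rpow_neg_succ_pos (a : ℝ) (n : ℕ) : 0 < ((n : ℝ) + 1) ^ (-a) := by positivity

theorem antitone_rpow_neg_succ {a : ℝ} (ha : 0 ≤ a) :
    Antitone fun n : ℕ => ((n : ℝ) + 1) ^ (-a) := fun m n h =>
  Real.rpow_le_rpow_of_nonpos (by positivity)
    (by have : (m : ℝ) ≤ n := by exact_mod_cast h
        linarith) (by linarith)

theorem rpow_neg_succ_le {a c : ℝ} (h : c ≤ a) (n : ℕ) :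
    ((n : ℝ) + 1) ^ (-a) ≤ ((n : ℝ) + 1) ^ (-c) :=
  Real.rpow_le_rpow_of_exponent_le (by linarith [n.cast_nonneg (α := ℝ)]) (by linarith)

theorem tendsto_rpow_neg_succ {a : ℝ} (ha : 0 < a) :
    Tendsto (fun n : ℕ => ((n : ℝ) + 1) ^ (-a)) atTop (𝓝 0) :=
  (tendsto_rpow_neg_atTop ha).comp
    (tendsto_atTop_add_const_right _ 1 tendsto_natCast_atTop_atTop)

theorem summable_rpow_neg_succ_rpow {a r : ℝ} (h : 1 < a * r) :
    Summable fun n : ℕ => (((n : ℝ) + 1) ^ (-a)) ^ r := by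
  have := (summable_nat_add_iff 1).2 (Real.summable_nat_rpow (p := -(a * r)) |>.2 (by linarith))
  refine this.congr fun n => ?_
  push_cast
  rw [← Real.rpow_mul (by positivity), neg_mul]

theorem tailSup_le_of_forall_norm_le {x : ℕ → ℂ} {a C : ℝ} (ha : 0 ≤ a) (hC : 0 ≤ C)
    (hx : ∀ n, ‖x n‖ ≤ C * ((n : ℝ) + 1) ^ (-a)) (n : ℕ) :
    tailSup x n ≤ C * ((n : ℝ) + 1) ^ (-a) :=
  ciSup_le fun k => (hx _).trans <|
    mul_le_mul_of_nonneg_left (antitone_rpow_neg_succ ha (Nat.le_add_right n k)) hC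

theorem nonneg_of_forall_norm_le {x : ℕ → ℂ} {a C : ℝ}
    (hx : ∀ n, ‖x n‖ ≤ C * ((n : ℝ) + 1) ^ (-a)) : 0 ≤ C := by
  have := (norm_nonneg _).trans (hx 0)
  simpa using this

/-- The bound is decreasing in `n`, so it passes to `x̂`, and its `r`-th powers are summable. The
hypothesis `har` also excludes `r = 0` and `r = ∞`, where `toReal` is `0`. -/
theorem mem_dSubmodule_of_forall_norm_le {x : ℕ → ℂ} {a C : ℝ} {r : ℝ≥0∞} (ha : 0 ≤ a)
    (har : 1 < a * r.toReal) (hx : ∀ n, ‖x n‖ ≤ C * ((n : ℝ) + 1) ^ (-a)) :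
    x ∈ dSubmodule r := by
  have hC := nonneg_of_forall_norm_le hx
  refine ⟨memℓp_infty ⟨C, ?_⟩, memℓp_gen ?_⟩
  · rintro _ ⟨n, rfl⟩
    refine (hx n).trans (mul_le_of_le_one_right hC ?_)
    simpa using antitone_rpow_neg_succ ha n.zero_le
  · refine Summable.of_nonneg_of_le (fun n => by positivity) (fun n => ?_)
      ((summable_rpow_neg_succ_rpow har).mul_left (C ^ r.toReal))
    rw [← Real.mul_rpow hC (by positivity), Real.norm_of_nonneg (tailSup_nonneg _ _)]
    exact Real.rpow_le_rpow (tailSup_nonneg _ _) (tailSup_le_of_forall_norm_le ha hC hx n)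
      ENNReal.toReal_nonneg

/-- The norm in `d(r)` of the sequence `(n + 1) ^ (-a)`. -/
def powerNorm (a r : ℝ) : ℝ := (∑' n : ℕ, (((n : ℝ) + 1) ^ (-a)) ^ r) ^ (1 / r)

theorem powerNorm_nonneg (a r : ℝ) : 0 ≤ powerNorm a r :=
  Real.rpow_nonneg (tsum_nonneg fun _ => by positivity) _

namespace DSpace

variable {q r : ℝ≥0∞}

theorem norm_le_of_forall_norm_le {a C : ℝ} (ha : 0 ≤ a) (har : 1 < a * r.toReal)
    (x : DSpace r) (hx : ∀ n, ‖toSeq x n‖ ≤ C * ((n : ℝ) + 1) ^ (-a)) :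
    ‖x‖ ≤ C * powerNorm a r.toReal := by
  have hr : 0 < r.toReal := by
    by_contra h
    rw [le_antisymm (not_lt.1 h) ENNReal.toReal_nonneg] at har
    norm_num at har
  have hC := nonneg_of_forall_norm_le hx
  refine lp.norm_le_of_tsum_le hr (mul_nonneg hC (powerNorm_nonneg _ _)) ?_
  have hs : 0 ≤ ∑' n : ℕ, (((n : ℝ) + 1) ^ (-a)) ^ r.toReal := tsum_nonneg fun _ => by positivity
  rw [Real.mul_rpow hC (powerNorm_nonneg _ _), powerNorm, ← Real.rpow_mul hs,
    one_div_mul_cancel hr.ne', Real.rpow_one, ← tsum_mul_left]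
  refine Summable.tsum_le_tsum (fun n => ?_) ((lp.memℓp (hat x)).summable hr)
    ((summable_rpow_neg_succ_rpow har).mul_left (C ^ r.toReal))
  rw [← Real.mul_rpow hC (by positivity)]
  change ‖tailSup (toSeq x) n‖ ^ r.toReal ≤ _
  rw [Real.norm_of_nonneg (tailSup_nonneg _ _)]
  exact Real.rpow_le_rpow (tailSup_nonneg _ _) (tailSup_le_of_forall_norm_le ha hC hx n) hr.le

/-- By monotonicity of `x̂`, `(n + 1) * x̂ n ^ q ≤ ∑_{i ≤ n} x̂ i ^ q ≤ ‖x‖ ^ q`. -/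
theorem norm_toSeq_le (hq : 0 < q.toReal) (x : DSpace q) (n : ℕ) :
    ‖toSeq x n‖ ≤ ‖x‖ * ((n : ℝ) + 1) ^ (-q.toReal⁻¹) := by
  have hx := toSeq_mem x
  refine (norm_le_tailSup hx.1 n).trans ?_
  have h0 : 0 ≤ ‖x‖ := lp.norm_nonneg' _
  have h1 := lp.sum_rpow_le_norm_rpow hq (hat x) (Finset.range (n + 1))
  have h2 : ∑ i ∈ Finset.range (n + 1), tailSup (toSeq x) n ^ q.toReal ≤
      ∑ i ∈ Finset.range (n + 1), ‖hat x i‖ ^ q.toReal := by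
    refine Finset.sum_le_sum fun i hi => ?_
    change _ ≤ ‖tailSup (toSeq x) i‖ ^ q.toReal
    rw [Real.norm_of_nonneg (tailSup_nonneg _ _)]
    exact Real.rpow_le_rpow (tailSup_nonneg _ _)
      (antitone_tailSup hx.1 (Nat.lt_succ_iff.1 (Finset.mem_range.1 hi))) hq.le
  have h3 : ((n : ℝ) + 1) * tailSup (toSeq x) n ^ q.toReal ≤ ‖x‖ ^ q.toReal := by
    simpa [norm_def] using h2.trans h1
  rw [← Real.rpow_le_rpow_iff (tailSup_nonneg _ _) (by positivity) hq,
    Real.mul_rpow h0 (by positivity), ← Real.rpow_mul (by positivity), neg_mul,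
    inv_mul_cancel₀ hq.ne', Real.rpow_neg_one, ← div_eq_mul_inv, le_div_iff₀ (by positivity)]
  linarith

/-- The shifts `n ↦ (k ↦ x (n + k))` of an element of `d(q)`, an element of `ℓ_q(ℓ_∞)`. -/
def shifts (x : DSpace q) : lp (fun _ : ℕ => lp (fun _ : ℕ => ℂ) ∞) q :=
  ⟨fun n => ⟨fun k => toSeq x (n + k), memℓp_infty (bddAbove_tail (toSeq_mem x).1 n)⟩,
    (toSeq_mem x).2.mono fun _ => le_rfl⟩

variable [Fact (1 ≤ q)]

/-- `d(q)` embeds isometrically into `ℓ_q(ℓ_∞)`. -/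
def shiftsIsometry (hq : 0 < q.toReal) :
    DSpace q →ₗᵢ[ℂ] lp (fun _ : ℕ => lp (fun _ : ℕ => ℂ) ∞) q where
  toFun := shifts
  map_add' _ _ := rfl
  map_smul' _ _ := rfl
  norm_map' x := by
    rw [norm_def, lp.norm_eq_tsum_rpow hq, lp.norm_eq_tsum_rpow hq]
    congr 1
    refine tsum_congr fun n => ?_
    congr 1
    exact (Real.norm_of_nonneg (tailSup_nonneg (toSeq x) n)).symm

/-- The range of the isometry into the Banach space `ℓ_q(ℓ_∞)` is cut out by equations between
continuous coordinates, hence closed. -/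
theorem completeSpace (hq : 0 < q.toReal) : CompleteSpace (DSpace q) := by
  have hcoord : ∀ n k : ℕ, Continuous
      fun z : lp (fun _ : ℕ => lp (fun _ : ℕ => ℂ) ∞) q => z n k := fun n k =>
    ((continuous_apply k).comp lp.uniformContinuous_coe.continuous).comp
      ((continuous_apply n).comp lp.uniformContinuous_coe.continuous)
  have hrange : Set.range (shiftsIsometry hq) = {z | ∀ n k : ℕ, z n k = z 0 (n + k)} := by
    ext z
    constructor
    · rintro ⟨x, rfl⟩ n k
      change toSeq x (n + k) = toSeq x (0 + (n + k))
      rw [zero_add]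
    · intro hz
      have hz' : ∀ n k : ℕ, z n k = z 0 (n + k) := hz
      have hmem : (z 0 : ℕ → ℂ) ∈ dSubmodule q := by
        refine ⟨lp.memℓp (z 0), (lp.memℓp z).mono' fun n => le_of_eq ?_⟩
        rw [Real.norm_of_nonneg (tailSup_nonneg _ _), lp.norm_eq_ciSup, tailSup]
        simp_rw [hz' n]
      refine ⟨⟨z 0, hmem⟩, lp.ext <| funext fun n => lp.ext <| funext fun k => (hz' n k).symm⟩
  have hclosed : IsClosed (Set.range (shiftsIsometry hq)) := by
    rw [hrange]
    simp only [Set.ofPred_forall]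
    exact isClosed_iInter fun n => isClosed_iInter fun k =>
      isClosed_eq (hcoord n k) (hcoord 0 (n + k))
  rw [completeSpace_iff_isComplete_range (shiftsIsometry hq).isometry.isUniformInducing]
  exact hclosed.isComplete

end DSpace

theorem Bornology.IsVonNBounded.exists_pos_forall_eq_smul {E : Type*} [AddCommGroup E]
    [Module ℂ E] [TopologicalSpace E] {B V : Set E} (hB : Bornology.IsVonNBounded ℂ B)
    (hV : V ∈ 𝓝 0) : ∃ R : ℝ, 0 < R ∧ ∀ x ∈ B, ∃ v ∈ V, x = (R : ℂ) • v := by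
  obtain ⟨R, hR, h⟩ := (hB hV).exists_pos
  refine ⟨R, hR, fun x hx => ?_⟩
  obtain ⟨v, hv, rfl⟩ := h (R : ℂ) (by simp [abs_of_pos hR]) hx
  exact ⟨v, hv, rfl⟩

/-! ### Exponents -/

section Exponents

variable {p : ℝ≥0∞}

theorem inv_toReal_lt_inv_toReal {q r : ℝ≥0∞} (hq : 0 < q) (h : q < r) :
    r.toReal⁻¹ < q.toReal⁻¹ := by
  have hq' : 0 < q.toReal := ENNReal.toReal_pos hq.ne' h.ne_top
  rcases eq_or_ne r ∞ with rfl | hr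
  · simpa using hq'
  · exact inv_strictAnti₀ hq' ((ENNReal.toReal_lt_toReal h.ne_top hr).2 h)

theorem toReal_pos_of_mem_Ioo (q : Set.Ioo 1 p) : 0 < (q : ℝ≥0∞).toReal :=
  ENNReal.toReal_pos (zero_lt_one.trans q.2.1).ne' q.2.2.ne_top

theorem inv_toReal_lt_one (hp : 1 < p) : p.toReal⁻¹ < 1 := by
  simpa using inv_toReal_lt_inv_toReal zero_lt_one hp

theorem exists_mem_Ioo_toReal_eq_inv (hp : 1 < p) {a : ℝ} (hpa : p.toReal⁻¹ < a) (ha : a < 1) :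
    ∃ q : Set.Ioo 1 p, (q : ℝ≥0∞).toReal = a⁻¹ := by
  have ha0 : 0 < a := (inv_nonneg.2 ENNReal.toReal_nonneg).trans_lt hpa
  refine ⟨⟨ENNReal.ofReal a⁻¹, ?_, ?_⟩, ENNReal.toReal_ofReal (inv_nonneg.2 ha0.le)⟩
  · rw [← ENNReal.ofReal_one]
    exact (ENNReal.ofReal_lt_ofReal_iff (by positivity)).2 ((one_lt_inv₀ ha0).2 ha)
  · rcases eq_or_ne p ∞ with rfl | hp'
    · exact ENNReal.ofReal_lt_top
    · exact (ENNReal.ofReal_lt_iff_lt_toReal (by positivity) hp').2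
        (inv_lt_of_inv_lt₀ (ENNReal.toReal_pos (zero_lt_one.trans hp).ne' hp') hpa)

theorem exists_mem_Ioo_one_lt_mul (hp : 1 < p) {a : ℝ} (hpa : p.toReal⁻¹ < a) :
    ∃ (q : Set.Ioo 1 p) (c : ℝ), 0 < c ∧ c < a ∧ 1 < c * (q : ℝ≥0∞).toReal := by
  -- The exponent will be `q = 1/d`: `d < 1` gives `q > 1`, and `d < a` leaves room for `c` with `c
  -- * q = c / d > 1`.
  obtain ⟨d, hpd, hd⟩ := exists_between (lt_min hpa (inv_toReal_lt_one hp))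
  have hd0 : 0 < d := (inv_nonneg.2 ENNReal.toReal_nonneg).trans_lt hpd
  obtain ⟨q, hq⟩ := exists_mem_Ioo_toReal_eq_inv hp hpd (hd.trans_le (min_le_right _ _))
  obtain ⟨c, hdc, hca⟩ := exists_between (hd.trans_le (min_le_left _ _))
  refine ⟨q, c, hd0.trans hdc, hca, ?_⟩
  rw [hq, ← div_eq_mul_inv]
  exact (one_lt_div hd0).2 hdc

end Exponents

/-! ### Basic properties of `d(p-)` -/

/-- Sequences of decay at most `C (n + 1) ^ (-a)`. -/
def polydisc (a C : ℝ) : Set (ℕ → ℂ) := {x | ∀ n, ‖x n‖ ≤ C * ((n : ℝ) + 1) ^ (-a)}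

theorem isCompact_polydisc (a C : ℝ) : IsCompact (polydisc a C) := by
  have : polydisc a C =
      Set.univ.pi fun n : ℕ => Metric.closedBall (0 : ℂ) (C * ((n : ℝ) + 1) ^ (-a)) := by
    ext x
    simp [polydisc]
  rw [this]
  exact isCompact_univ_pi fun n => isCompact_closedBall _ _

theorem polydisc_subset_polydisc {a c C : ℝ} (h : c ≤ a) (hC : 0 ≤ C) :
    polydisc a C ⊆ polydisc c C := fun _ hx n =>
  (hx n).trans (mul_le_mul_of_nonneg_left (rpow_neg_succ_le h n) hC)

section BasicProperties

variable (p : ℝ≥0∞) [Fact (1 < p)]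

theorem mem_dMinusSubmodule_iff {x : ℕ → ℂ} :
    x ∈ dMinusSubmodule p ↔ ∃ a, p.toReal⁻¹ < a ∧ ∃ C, x ∈ polydisc a C := by
  constructor
  · intro hx
    obtain ⟨q, hq, hx⟩ := Set.mem_iUnion₂.1 hx
    exact ⟨q.toReal⁻¹, inv_toReal_lt_inv_toReal (zero_lt_one.trans hq.1) hq.2,
      ‖show DSpace q from ⟨x, hx⟩‖, DSpace.norm_toSeq_le (toReal_pos_of_mem_Ioo ⟨q, hq⟩) ⟨x, hx⟩⟩
  · rintro ⟨a, ha, C, hx⟩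
    obtain ⟨q, c, hc, hca, hcq⟩ := exists_mem_Ioo_one_lt_mul (p := p) Fact.out ha
    exact dSubmodule_le_dMinusSubmodule p q (mem_dSubmodule_of_forall_norm_le hc.le hcq
      (polydisc_subset_polydisc hca.le (nonneg_of_forall_norm_le hx) hx))

namespace DMinus

instance : IsTopologicalAddGroup (DMinus p) := (inductiveLimitTopology_spec (ofStep p)).1

instance : ContinuousSMul ℂ (DMinus p) := (inductiveLimitTopology_spec (ofStep p)).2.1

instance : LocallyConvexSpace ℝ (DMinus p) := (inductiveLimitTopology_spec (ofStep p)).2.2.1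

theorem continuous_ofStep (q : Set.Ioo 1 p) : Continuous (ofStep p q) :=
  (inductiveLimitTopology_spec (ofStep p)).2.2.2 q

theorem toSeq_injective : Function.Injective (toSeq p) := Subtype.val_injective

theorem toSeq_mem (x : DMinus p) : toSeq p x ∈ dMinusSubmodule p := Subtype.property x

/-- A sequence in the underlying vector space, as an element of `d(p-)`. -/
def mk (x : ℕ → ℂ) (hx : x ∈ dMinusSubmodule p) : DMinus p := ⟨x, hx⟩

@[simp] theorem toSeq_mk (x : ℕ → ℂ) (hx : x ∈ dMinusSubmodule p) : toSeq p (mk p x hx) = x := rfl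

theorem continuous_toSeq : Continuous (toSeq p) := by
  refine continuous_inductiveLimitTopology_dom (ofStep p) (toSeq p) fun q => ?_
  refine continuous_pi fun n => ?_
  refine AddMonoidHomClass.continuous_of_bound
    ((LinearMap.proj n).comp (DSpace.toSeq (q := q))) (((n : ℝ) + 1) ^ (-(q : ℝ≥0∞).toReal⁻¹))
    fun x => ?_
  rw [mul_comm]
  exact DSpace.norm_toSeq_le (toReal_pos_of_mem_Ioo q) x n

instance : T2Space (DMinus p) := .of_injective_continuous (toSeq_injective p) (continuous_toSeq p)

instance : BarrelledSpace ℂ (DMinus p) := by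
  have (q : Set.Ioo 1 p) : CompleteSpace (DSpace q) :=
    DSpace.completeSpace (toReal_pos_of_mem_Ioo q)
  exact barrelledSpace_inductiveLimitTopology (ofStep p)

theorem polydisc_subset {a : ℝ} (ha : p.toReal⁻¹ < a) (C : ℝ) :
    polydisc a C ⊆ dMinusSubmodule p := fun _ hx => (mem_dMinusSubmodule_iff p).2 ⟨a, ha, C, hx⟩

/-- On polydiscs, the topology of `d(p-)` is coarser than the one of coordinatewise
convergence. -/
theorem continuous_mk_polydisc {a : ℝ} (ha : p.toReal⁻¹ < a) (C : ℝ) :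
    Continuous fun x : polydisc a C => mk p x (polydisc_subset p ha C x.2) := by
  obtain ⟨q, c, hc, hca, hcq⟩ := exists_mem_Ioo_one_lt_mul (p := p) Fact.out ha
  have hmem : ∀ x ∈ polydisc a C, x ∈ dSubmodule q := fun x hx =>
    mem_dSubmodule_of_forall_norm_le hc.le hcq
      (polydisc_subset_polydisc hca.le (nonneg_of_forall_norm_le hx) hx)
  let g : polydisc a C → DSpace q := fun x => ⟨x, hmem x x.2⟩
  suffices hg : Continuous g from (continuous_ofStep p q).comp hg
  refine continuous_iff_continuousAt.2 fun x₀ => Metric.tendsto_nhds.2 fun ε hε => ?_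
  obtain ⟨η, hη, hηε⟩ : ∃ η > 0, η * powerNorm c (q : ℝ≥0∞).toReal < ε := by
    refine ⟨ε / (powerNorm c (q : ℝ≥0∞).toReal + 1), ?_, ?_⟩
    · have := powerNorm_nonneg c (q : ℝ≥0∞).toReal
      positivity
    · have := powerNorm_nonneg c (q : ℝ≥0∞).toReal
      rw [div_mul_eq_mul_div, div_lt_iff₀ (by positivity)]
      nlinarith
  -- Points of the polydisc differ by at most `2 * C * (n + 1) ^ (-a)`, which beyond some `N` is
  -- below `η * (n + 1) ^ (-c)`; only the first `N` coordinates need to be close.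
  have hlim : Tendsto (fun n : ℕ => 2 * C * ((n : ℝ) + 1) ^ (-(a - c))) atTop (𝓝 0) := by
    simpa using (tendsto_rpow_neg_succ (sub_pos.2 hca)).const_mul (2 * C)
  obtain ⟨N, hN⟩ := eventually_atTop.1 (hlim.eventually_lt_const hη)
  have hev : ∀ᶠ x : polydisc a C in 𝓝 x₀, ∀ n ∈ Finset.range N,
      ‖(x : ℕ → ℂ) n - (x₀ : ℕ → ℂ) n‖ < η * ((n : ℝ) + 1) ^ (-c) := by
    refine (Finset.eventually_all _).2 fun n _ => ?_
    have hcont : Continuous fun x : polydisc a C => ‖(x : ℕ → ℂ) n - (x₀ : ℕ → ℂ) n‖ :=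
      (((continuous_apply n).comp continuous_subtype_val).sub continuous_const).norm
    refine hcont.continuousAt.eventually_lt_const ?_
    simp only [sub_self, norm_zero]
    exact mul_pos hη (rpow_neg_succ_pos c n)
  filter_upwards [hev] with x hx
  rw [dist_eq_norm]
  refine lt_of_le_of_lt (DSpace.norm_le_of_forall_norm_le hc.le hcq _ fun n => ?_) hηε
  change ‖(x : ℕ → ℂ) n - (x₀ : ℕ → ℂ) n‖ ≤ _
  rcases lt_or_ge n N with h | h
  · exact (hx n (Finset.mem_range.2 h)).le
  · calc ‖(x : ℕ → ℂ) n - (x₀ : ℕ → ℂ) n‖ ≤ ‖(x : ℕ → ℂ) n‖ + ‖(x₀ : ℕ → ℂ) n‖ := norm_sub_le _ _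
      _ ≤ C * ((n : ℝ) + 1) ^ (-a) + C * ((n : ℝ) + 1) ^ (-a) := add_le_add (x.2 n) (x₀.2 n)
      _ = (2 * C * ((n : ℝ) + 1) ^ (-(a - c))) * ((n : ℝ) + 1) ^ (-c) := by
        rw [mul_assoc (2 * C), ← Real.rpow_add (by positivity), show -(a - c) + -c = -a by ring]
        ring
      _ ≤ η * ((n : ℝ) + 1) ^ (-c) :=
        mul_le_mul_of_nonneg_right (hN n h).le (rpow_neg_succ_pos c n).le

theorem isCompact_preimage_polydisc {a : ℝ} (ha : p.toReal⁻¹ < a) (C : ℝ) :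
    IsCompact (toSeq p ⁻¹' polydisc a C) := by
  have := isCompact_iff_compactSpace.1 (isCompact_polydisc a C)
  convert isCompact_range (continuous_mk_polydisc p ha C) using 1
  ext x
  constructor
  · intro hx
    exact ⟨⟨toSeq p x, hx⟩, rfl⟩
  · rintro ⟨y, rfl⟩
    exact y.2

theorem exists_mem_polydisc (x : DMinus p) :
    ∃ a, p.toReal⁻¹ < a ∧ ∃ C, toSeq p x ∈ polydisc a C :=
  (mem_dMinusSubmodule_iff p).1 (toSeq_mem p x)

/-- Bounded subsets of `d(p-)` are contained in polydiscs. -/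
theorem exists_subset_polydisc {B : Set (DMinus p)} (hB : Bornology.IsVonNBounded ℂ B) :
    ∃ a, p.toReal⁻¹ < a ∧ ∃ C, B ⊆ toSeq p ⁻¹' polydisc a C := by
  by_contra! hcon
  obtain ⟨u, -, hu, hlim⟩ := exists_seq_strictAnti_tendsto p.toReal⁻¹
  -- If no polydisc contains `B`, the one of exponent `u k` and radius `k` is violated at some
  -- coordinate `n k` by some `x k ∈ B`.
  have hex : ∀ k : ℕ, ∃ x ∈ B, ∃ n : ℕ, k < ‖toSeq p x n‖ * ((n : ℝ) + 1) ^ (u k) := by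
    intro k
    obtain ⟨x, hx, hxk⟩ := Set.not_subset.1 (hcon (u k) (hu k) k)
    simp only [polydisc, Set.mem_preimage, Set.mem_ofPred_eq, not_forall, not_le] at hxk
    obtain ⟨n, hn⟩ := hxk
    refine ⟨x, hx, n, ?_⟩
    rwa [Real.rpow_neg (by positivity), ← div_eq_mul_inv, div_lt_iff₀ (by positivity)] at hn
  choose x hx n hn using hex
  -- A fixed `y` decays with some exponent `a > 1/p`, and `u k < a` for all large `k`.
  have hbdd : ∀ y : DMinus p, BddAbove (Set.range fun k : ℕ =>
      ‖toSeq p y (n k)‖ * ((n k : ℝ) + 1) ^ (u k)) := by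
    intro y
    obtain ⟨a, ha, C, hy⟩ := exists_mem_polydisc p y
    have hC := nonneg_of_forall_norm_le hy
    refine (isBoundedUnder_of_eventually_le (a := C) ?_).bddAbove_range
    filter_upwards [hlim.eventually_lt_const ha] with k hk
    calc ‖toSeq p y (n k)‖ * ((n k : ℝ) + 1) ^ (u k)
        ≤ C * ((n k : ℝ) + 1) ^ (-a) * ((n k : ℝ) + 1) ^ (u k) :=
          mul_le_mul_of_nonneg_right (hy (n k)) (by positivity)
      _ = C * ((n k : ℝ) + 1) ^ (-(a - u k)) := by
          rw [mul_assoc, ← Real.rpow_add (by positivity)]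
          ring_nf
      _ ≤ C := mul_le_of_le_one_right hC <|
          Real.rpow_le_one_of_one_le_of_nonpos (by linarith [(n k).cast_nonneg (α := ℝ)])
            (by linarith)
  -- This supremum of continuous seminorms is lower semicontinuous, so continuous by barrelledness;
  -- it is then bounded on `B`, although `σ (x k) > k`.
  let σ : Seminorm ℂ (DMinus p) := .of
    (fun y => ⨆ k : ℕ, ‖toSeq p y (n k)‖ * ((n k : ℝ) + 1) ^ (u k))
    (fun y z => by
      refine ciSup_le fun k => ?_
      refine le_trans ?_ (add_le_add (le_ciSup (hbdd y) k) (le_ciSup (hbdd z) k))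
      rw [← add_mul, map_add]
      exact mul_le_mul_of_nonneg_right (norm_add_le _ _) (by positivity))
    (fun c y => by
      rw [Real.mul_iSup_of_nonneg (norm_nonneg c)]
      simp [mul_assoc])
  have hle (y : DMinus p) (k : ℕ) : ‖toSeq p y (n k)‖ * ((n k : ℝ) + 1) ^ (u k) ≤ σ y :=
    le_ciSup (hbdd y) k
  have hσ : Continuous σ := by
    refine σ.continuous_of_lowerSemicontinuous (lowerSemicontinuous_ciSup hbdd fun k => ?_)
    exact (((continuous_apply (n k)).comp (continuous_toSeq p)).norm.mul_const _).lowerSemicontinuous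
  have hV : {y | σ y < 1} ∈ 𝓝 (0 : DMinus p) :=
    hσ.continuousAt.eventually_lt_const (by rw [map_zero]; exact zero_lt_one)
  obtain ⟨R, hR, h⟩ := hB.exists_pos_forall_eq_smul hV
  obtain ⟨k, hk⟩ := exists_nat_gt R
  obtain ⟨v, hv, hxv⟩ := h (x k) (hx k)
  have h₁ : σ (x k) ≤ R := by
    rw [hxv, map_smul_eq_mul, Complex.norm_real, Real.norm_of_nonneg hR.le]
    exact mul_le_of_le_one_right hR.le (le_of_lt hv)
  linarith [hn k, hle (x k) k]

instance : MontelSpace ℂ (DMinus p) := by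
  refine ⟨fun B hB hb => ?_⟩
  obtain ⟨a, ha, C, h⟩ := exists_subset_polydisc p hb
  exact (isCompact_preimage_polydisc p ha C).of_isClosed_subset hB h

theorem isMontelSpace : IsMontelSpace (DMinus p) where
  isTopologicalAddGroup := inferInstance
  continuousSMul := inferInstance
  locallyConvexSpace := inferInstance
  t2Space := inferInstance
  barrelledSpace := inferInstance
  montelSpace := inferInstance

end DMinus

end BasicProperties

/-! ### Echelon spaces -/

/-- The Köthe echelon space of the sequences `y` with `∑ |y n| (n + 1) ^ (-u k) < ∞` for all `k`.
It is realized as a subspace of a countable product of copies of `ℓ_1`, the `k`-th component being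
`y n * (n + 1) ^ (-u k)`. -/
def echelon (u : ℕ → ℝ) : Submodule ℂ (ℕ → lp (fun _ : ℕ => ℂ) 1) where
  carrier := {z | ∀ k n : ℕ, ((((n : ℝ) + 1) ^ u k : ℝ) : ℂ) * z k n =
    ((((n : ℝ) + 1) ^ u 0 : ℝ) : ℂ) * z 0 n}
  zero_mem' k n := by simp
  add_mem' {y z} hy hz k n := by
    have h1 := hy k n
    have h2 := hz k n
    simp only [Pi.add_apply, lp.coeFn_add, mul_add] at *
    rw [h1, h2]
  smul_mem' c z hz k n := by
    have h := hz k n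
    simp only [Pi.smul_apply, lp.coeFn_smul, smul_eq_mul, mul_left_comm _ c] at *
    rw [h]

namespace echelon

variable {u : ℕ → ℝ}

theorem continuous_apply_apply (k n : ℕ) :
    Continuous fun z : ℕ → lp (fun _ : ℕ => ℂ) 1 => z k n :=
  ((continuous_apply n).comp lp.uniformContinuous_coe.continuous).comp (continuous_apply k)

theorem isClosed : IsClosed (echelon u : Set (ℕ → lp (fun _ : ℕ => ℂ) 1)) := by
  change IsClosed {z : ℕ → lp (fun _ : ℕ => ℂ) 1 | ∀ k n : ℕ, _}
  simp only [Set.ofPred_forall]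
  exact isClosed_iInter fun k => isClosed_iInter fun n =>
    isClosed_eq (continuous_const.mul (continuous_apply_apply k n))
      (continuous_const.mul (continuous_apply_apply 0 n))

theorem isFrechetSpace : IsFrechetSpace (echelon u) where
  isUniformAddGroup := (echelon u).toAddSubgroup.isUniformAddGroup
  continuousSMul := inferInstance
  locallyConvexSpace := LocallyConvexSpace.induced ((echelon u).subtype.restrictScalars ℝ)
  t2Space := inferInstance
  isCountablyGenerated := inferInstanceAs
    (uniformity (echelon u : Set (ℕ → lp (fun _ : ℕ => ℂ) 1))).IsCountablyGenerated
  completeSpace := isClosed.completeSpace_coe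

/-- The sequence underlying an element of the echelon space. -/
def coord (n : ℕ) (z : echelon u) : ℂ := ((((n : ℝ) + 1) ^ u 0 : ℝ) : ℂ) * z.1 0 n

theorem coord_add (n : ℕ) (y z : echelon u) : coord n (y + z) = coord n y + coord n z :=
  mul_add _ _ _

theorem coord_smul (n : ℕ) (c : ℂ) (z : echelon u) : coord n (c • z) = c * coord n z :=
  mul_left_comm _ _ _

theorem coord_eq (n k : ℕ) (z : echelon u) :
    coord n z = ((((n : ℝ) + 1) ^ u k : ℝ) : ℂ) * z.1 k n := (z.2 k n).symm

theorem apply_eq (n k : ℕ) (z : echelon u) :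
    z.1 k n = ((((n : ℝ) + 1) ^ (-u k) : ℝ) : ℂ) * coord n z := by
  rw [coord_eq n k, ← mul_assoc, ← Complex.ofReal_mul, ← Real.rpow_add (by positivity)]
  simp

theorem norm_apply_eq (n k : ℕ) (z : echelon u) :
    ‖z.1 k n‖ = ((n : ℝ) + 1) ^ (-u k) * ‖coord n z‖ := by
  rw [apply_eq n k, norm_mul, Complex.norm_real, Real.norm_of_nonneg (by positivity)]

theorem hasSum_norm (k : ℕ) (z : echelon u) :
    HasSum (fun n : ℕ => ((n : ℝ) + 1) ^ (-u k) * ‖coord n z‖) ‖z.1 k‖ := by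
  have := lp.hasSum_norm (by simp) (z.1 k)
  simpa [norm_apply_eq] using this

/-- A sequence satisfying the summability conditions, as an element of the echelon space. -/
def mk (y : ℕ → ℂ) (hy : ∀ k, Summable fun n : ℕ => ((n : ℝ) + 1) ^ (-u k) * ‖y n‖) : echelon u :=
  ⟨fun k => ⟨fun n => ((((n : ℝ) + 1) ^ (-u k) : ℝ) : ℂ) * y n, memℓp_gen <| by
    refine (hy k).congr fun n => ?_
    rw [norm_mul, Complex.norm_real, Real.norm_of_nonneg (by positivity)]
    simp⟩, fun k n => by
    simp only [← mul_assoc, ← Complex.ofReal_mul, ← Real.rpow_add (show 0 < (n : ℝ) + 1 by positivity)]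
    simp⟩

theorem coord_mk (y : ℕ → ℂ) (hy : ∀ k, Summable fun n : ℕ => ((n : ℝ) + 1) ^ (-u k) * ‖y n‖)
    (n : ℕ) : coord n (mk y hy) = y n := by
  change ((((n : ℝ) + 1) ^ u 0 : ℝ) : ℂ) * (((((n : ℝ) + 1) ^ (-u 0) : ℝ) : ℂ) * y n) = y n
  rw [← mul_assoc, ← Complex.ofReal_mul, ← Real.rpow_add (show 0 < (n : ℝ) + 1 by positivity)]
  simp

variable (u) in
/-- The unit vectors of the echelon space. -/
def single (n : ℕ) : echelon u :=
  mk (Pi.single n 1) fun k => summable_of_ne_finset_zero (s := {n}) fun m hm => by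
    rw [Pi.single_eq_of_ne (by simpa using hm)]
    simp

theorem coord_single (m n : ℕ) : coord m (single u n) = Pi.single (M := fun _ => ℂ) n 1 m :=
  coord_mk _ _ _

theorem norm_single_apply (n k : ℕ) : ‖(single u n).1 k‖ = ((n : ℝ) + 1) ^ (-u k) := by
  refine (hasSum_norm k (single u n)).unique ?_
  convert hasSum_single n fun m hm => ?_ using 1
  · simp [coord_single]
  · simp [coord_single, hm]

theorem coord_smul_single_apply (n k : ℕ) (z : echelon u) :
    (coord n z • single u n).1 k = lp.single 1 n (z.1 k n) := by
  refine lp.ext <| funext fun m => ?_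
  rw [apply_eq, coord_smul, coord_single, lp.single_apply]
  rcases eq_or_ne m n with rfl | h
  · simp [apply_eq m k z]
  · simp [h]

theorem hasSum_coord_smul_single (z : echelon u) :
    HasSum (fun n => coord n z • single u n) z := by
  refine (Topology.IsInducing.hasSum_iff (g := (echelon u).subtype) .subtypeVal _ _).1
    (Pi.hasSum.2 ?_)
  intro k
  convert lp.hasSum_single ENNReal.one_ne_top (z.1 k) using 2 with n
  · exact coord_smul_single_apply n k z
  · rfl

theorem sub_sum_apply (N k m : ℕ) (z : echelon u) :
    (z - ∑ n ∈ Finset.range N, coord n z • single u n).1 k m = if m < N then 0 else z.1 k m := by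
  have h : (∑ n ∈ Finset.range N, coord n z • single u n).1 k =
      ∑ n ∈ Finset.range N, lp.single 1 n (z.1 k n) := by
    simp only [← coord_smul_single_apply, AddSubmonoidClass.coe_finsetSum, Finset.sum_apply]
  change z.1 k m - (∑ n ∈ Finset.range N, coord n z • single u n).1 k m = _
  rw [h, lp.coeFn_sum, Finset.sum_apply]
  simp only [lp.single_apply, Finset.sum_pi_single, Finset.mem_range]
  split_ifs <;> simp

theorem norm_apply_le_of_forall_le {k l : ℕ} {c : ℝ} {y z : echelon u}
    (h : ∀ n, ‖y.1 k n‖ ≤ c * ‖z.1 l n‖) : ‖y.1 k‖ ≤ c * ‖z.1 l‖ := by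
  have h1 := lp.hasSum_norm (by simp) (y.1 k)
  have h2 := (lp.hasSum_norm (by simp) (z.1 l)).mul_left c
  simp only [ENNReal.toReal_one, Real.rpow_one] at h1 h2
  exact hasSum_le h h1 h2

theorem norm_apply_mono (hu : Antitone u) (z : echelon u) : Monotone fun k => ‖z.1 k‖ := by
  intro k l hkl
  have := norm_apply_le_of_forall_le (y := z) (z := z) (k := k) (l := l) (c := 1) fun n => by
    rw [norm_apply_eq, norm_apply_eq, one_mul]
    exact mul_le_mul_of_nonneg_right (rpow_neg_succ_le (hu hkl) n) (norm_nonneg _)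
  simpa using this

theorem continuous_apply (k : ℕ) : Continuous fun z : echelon u => z.1 k :=
  (_root_.continuous_apply k).comp continuous_subtype_val

theorem ball_mem_nhds (k : ℕ) {δ : ℝ} (hδ : 0 < δ) : {z : echelon u | ‖z.1 k‖ < δ} ∈ 𝓝 0 :=
  (continuous_apply k).norm.continuousAt.eventually_lt_const (by simpa using hδ)

/-- The seminorms increase with `k`, so the finitely many occurring in a product neighbourhood are
dominated by one. -/
theorem exists_ball_subset (hu : Antitone u) {U : Set (echelon u)} (hU : U ∈ 𝓝 0) :
    ∃ k, ∃ δ > 0, {z : echelon u | ‖z.1 k‖ < δ} ⊆ U := by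
  rw [nhds_subtype, Filter.mem_comap] at hU
  obtain ⟨W, hW, hWU⟩ := hU
  rw [nhds_pi, Filter.mem_pi] at hW
  obtain ⟨I, hI, t, ht, hIW⟩ := hW
  choose δ hδ hδt using fun i => Metric.mem_nhds_iff.1 (ht i)
  obtain ⟨k, hk⟩ := hI.bddAbove
  obtain ⟨η, hη, hηδ⟩ : ∃ η > 0, ∀ i ∈ I, η ≤ δ i := by
    rcases I.eq_empty_or_nonempty with rfl | hne
    · exact ⟨1, one_pos, by simp⟩
    · obtain ⟨i, -, h⟩ := Set.exists_min_image I δ hI hne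
      exact ⟨δ i, hδ i, h⟩
  refine ⟨k, η, hη, fun z hz => hWU (hIW fun i hi => hδt i ?_)⟩
  rw [mem_ball_iff_norm]
  change ‖z.1 i - 0‖ < _
  rw [sub_zero]
  exact ((norm_apply_mono hu z (hk hi)).trans_lt hz).trans_le (hηδ i hi)

theorem isVonNBounded_iff (hu : Antitone u) {B : Set (echelon u)} :
    Bornology.IsVonNBounded ℂ B ↔ ∀ k, ∃ R, ∀ z ∈ B, ‖z.1 k‖ ≤ R := by
  constructor
  · intro hB k
    obtain ⟨R, hR, h⟩ := hB.exists_pos_forall_eq_smul (ball_mem_nhds k one_pos)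
    refine ⟨R, fun z hz => ?_⟩
    obtain ⟨v, hv, rfl⟩ := h z hz
    change ‖(R : ℂ) • v.1 k‖ ≤ R
    rw [norm_smul, Complex.norm_real, Real.norm_of_nonneg hR.le]
    exact mul_le_of_le_one_right hR.le (le_of_lt hv)
  · intro h U hU
    obtain ⟨k, δ, hδ, hkU⟩ := exists_ball_subset hu hU
    obtain ⟨R, hR⟩ := h k
    refine Absorbs.mono_left ?_ hkU
    refine (absorbs_iff_norm).2 ⟨(|R| + 1) / δ, fun c hc z hz => ?_⟩
    have hc0 : 0 < ‖c‖ := lt_of_lt_of_le (by positivity) hc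
    refine ⟨c⁻¹ • z, ?_, smul_inv_smul₀ (norm_pos_iff.1 hc0) z⟩
    change ‖c⁻¹ • z.1 k‖ < δ
    rw [norm_smul, norm_inv, inv_mul_lt_iff₀ hc0]
    rw [div_le_iff₀ hδ] at hc
    linarith [hR z hz, le_abs_self R]

/-- On the unit ball of seminorm `k + 1`, tails are uniformly small in seminorm `k`, since the
quotient of the weights tends to zero. The initial sections lie in a compact set, which finitely
many small balls cover. -/
theorem hasSchwartzProperty (hu : StrictAnti u) : HasSchwartzProperty (echelon u) := by
  intro U hU
  obtain ⟨k, δ, hδ, hkU⟩ := exists_ball_subset hu.antitone hU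
  refine ⟨_, ball_mem_nhds (k + 1) one_pos, fun ε hε => ?_⟩
  have hlim := tendsto_rpow_neg_succ (sub_pos.2 (hu k.lt_succ_self))
  have hεδ : 0 < ε * δ / 2 := by positivity
  obtain ⟨N, hN⟩ := eventually_atTop.1 (hlim.eventually_lt_const hεδ)
  let T : (ℕ → ℂ) → echelon u := fun c => ∑ n ∈ Finset.range N, c n • single u n
  have hT : Continuous T := continuous_finsetSum _ fun n _ =>
    (_root_.continuous_apply n).smul continuous_const
  -- The negated exponent makes this a growth bound: `‖v.1 (k + 1)‖ < 1` forces `‖coord n v‖ ≤ (n +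
  -- 1) ^ u (k + 1)`.
  have hK : IsCompact (T '' polydisc (-u (k + 1)) 1) := (isCompact_polydisc _ _).image hT
  obtain ⟨s, -, hs⟩ := hK.elim_nhds_subcover (fun x => {z | ‖(z - x).1 k‖ < ε * δ / 2})
    fun x _ => by
      have hc : Continuous fun z : echelon u => ‖(z - x).1 k‖ :=
        ((continuous_apply k).comp (continuous_id.sub continuous_const)).norm
      exact hc.continuousAt.eventually_lt_const (by simpa using hεδ)
  refine ⟨s, s.finite_toSet, fun v hv => ?_⟩
  have hvN : T (fun n => coord n v) ∈ T '' polydisc (-u (k + 1)) 1 := by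
    refine ⟨_, fun n => ?_, rfl⟩
    rw [coord_eq n (k + 1), norm_mul, Complex.norm_real, Real.norm_of_nonneg (by positivity),
      neg_neg, mul_comm]
    exact mul_le_mul_of_nonneg_right
      ((lp.norm_apply_le_norm one_ne_zero _ n).trans (le_of_lt hv)) (by positivity)
  obtain ⟨x, hx, hxv⟩ := Set.mem_iUnion₂.1 (hs hvN)
  have htail : ‖(v - T fun n => coord n v).1 k‖ ≤ ε * δ / 2 * ‖v.1 (k + 1)‖ := by
    refine norm_apply_le_of_forall_le fun n => ?_
    rw [sub_sum_apply]
    split_ifs with h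
    · simp only [norm_zero]
      positivity
    · rw [norm_apply_eq, norm_apply_eq, ← mul_assoc]
      refine mul_le_mul_of_nonneg_right ?_ (norm_nonneg _)
      have := mul_le_mul_of_nonneg_right (hN n (not_lt.1 h)).le (rpow_neg_succ_pos (u (k + 1)) n).le
      rwa [← Real.rpow_add (by positivity),
        show -(u k - u (k + 1)) + -u (k + 1) = -u k by ring] at this
  have hvx : ‖(v - x).1 k‖ < ε * δ := by
    have h1 : (v - x).1 k = (v - T fun n => coord n v).1 k + (T (fun n => coord n v) - x).1 k := by
      change v.1 k - x.1 k = (v.1 k - (T fun n => coord n v).1 k) +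
        ((T fun n => coord n v).1 k - x.1 k)
      abel
    have h2 : ‖v.1 (k + 1)‖ < 1 := hv
    have h3 : ‖(T (fun n => coord n v) - x).1 k‖ < ε * δ / 2 := hxv
    rw [h1]
    refine (norm_add_le _ _).trans_lt ?_
    nlinarith
  refine ⟨x, hx, (ε : ℂ)⁻¹ • (v - x), hkU ?_, ?_⟩
  · change ‖(ε : ℂ)⁻¹ • (v - x).1 k‖ < δ
    rw [norm_smul, norm_inv, Complex.norm_real, Real.norm_of_nonneg hε.le, inv_mul_lt_iff₀ hε]
    exact hvx
  · rw [← Complex.coe_smul ε, smul_inv_smul₀ (by exact_mod_cast hε.ne')]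
    abel

end echelon

/-! ### Duality between `d(p-)` and the echelon space -/

theorem LinearMap.continuous_strongDual_of_bound {X F : Type*} [NormedAddCommGroup X]
    [NormedSpace ℂ X] [AddCommGroup F] [Module ℂ F] [TopologicalSpace F]
    (f : X →ₗ[ℂ] StrongDual ℂ F)
    (hf : ∀ B, Bornology.IsVonNBounded ℂ B → ∃ R : ℝ, ∀ x, ∀ z ∈ B, ‖f x z‖ ≤ ‖x‖ * R) :
    Continuous f := by
  refine continuous_of_continuousAt_zero f ?_
  rw [ContinuousAt, map_zero]
  refine (ContinuousLinearMap.hasBasis_nhds_zero_of_basis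
    Metric.nhds_basis_ball).tendsto_right_iff.2 ?_
  rintro ⟨B, ε⟩ ⟨hB, hε⟩
  obtain ⟨R, hR⟩ := hf B hB
  have hcont : Continuous fun x : X => ‖x‖ * R := continuous_norm.mul_const _
  filter_upwards [(hcont.tendsto 0).eventually_lt_const (u := ε) (by simpa using hε)] with x hx z hz
  rw [mem_ball_zero_iff]
  exact (hR x z hz).trans_lt hx

section Duality

open echelon

variable {u : ℕ → ℝ}

theorem norm_mul_coord_le {x : ℕ → ℂ} {k : ℕ} {C : ℝ} (hx : x ∈ polydisc (u k) C)
    (z : echelon u) (n : ℕ) :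
    ‖x n * coord n z‖ ≤ C * (((n : ℝ) + 1) ^ (-u k) * ‖coord n z‖) := by
  rw [norm_mul, ← mul_assoc]
  exact mul_le_mul_of_nonneg_right (hx n) (norm_nonneg _)

theorem summable_mul_coord {x : ℕ → ℂ} {k : ℕ} {C : ℝ} (hx : x ∈ polydisc (u k) C)
    (z : echelon u) : Summable fun n => x n * coord n z :=
  .of_norm_bounded ((hasSum_norm k z).summable.mul_left C) (norm_mul_coord_le hx z)

theorem norm_tsum_mul_coord_le {x : ℕ → ℂ} {k : ℕ} {C : ℝ} (hx : x ∈ polydisc (u k) C)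
    (z : echelon u) : ‖∑' n, x n * coord n z‖ ≤ C * ‖z.1 k‖ :=
  tsum_of_norm_bounded ((hasSum_norm k z).mul_left C) (norm_mul_coord_le hx z)

theorem single_mem_polydisc (n : ℕ) (a : ℝ) :
    (Pi.single n 1 : ℕ → ℂ) ∈ polydisc a (((n : ℝ) + 1) ^ a) := by
  intro m
  rcases eq_or_ne m n with rfl | h
  · rw [← Real.rpow_add (by positivity)]
    simp
  · rw [Pi.single_eq_of_ne h, norm_zero]
    positivity

theorem ite_lt_mem_polydisc {x : ℕ → ℂ} {a C : ℝ} (hx : x ∈ polydisc a C) (N : ℕ) :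
    (fun n => if n < N then x n else 0) ∈ polydisc a C := fun n => by
  have := hx n
  dsimp only
  split_ifs
  · exact this
  · rw [norm_zero]
    exact (norm_nonneg _).trans this

theorem Complex.exists_norm_le_one_mul_eq_norm (y : ℂ) : ∃ c : ℂ, ‖c‖ ≤ 1 ∧ c * y = ‖y‖ := by
  rcases eq_or_ne y 0 with rfl | h
  · exact ⟨0, by simp, by simp⟩
  · refine ⟨‖y‖ / y, ?_, div_mul_cancel₀ _ h⟩
    rw [norm_div, Complex.norm_real, norm_norm, div_self (norm_ne_zero_iff.2 h)]

namespace DMinus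

variable (p : ℝ≥0∞) [Fact (1 < p)]

/-- The unit vectors of `d(p-)`. -/
def single (n : ℕ) : DMinus p := mk p (Pi.single n 1) <|
  polydisc_subset p (lt_add_one _) _ (single_mem_polydisc n (p.toReal⁻¹ + 1))

theorem mk_ite_lt_eq_sum {x : ℕ → ℂ} {N : ℕ}
    (hx : (fun n => if n < N then x n else 0) ∈ dMinusSubmodule p) :
    mk p _ hx = ∑ n ∈ Finset.range N, x n • single p n := by
  apply toSeq_injective
  funext m
  simp [single, Pi.single_apply, Finset.sum_apply]

/-- The sum is the value of `f` at a finitely supported point of the polydisc whose phases are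
aligned with the `f (single p n)`. -/
theorem sum_norm_le {f : DMinus p →ₗ[ℂ] ℂ} {a M : ℝ} (ha : p.toReal⁻¹ < a)
    (hM : ∀ x, toSeq p x ∈ polydisc a 1 → (f x).re ≤ M) (N : ℕ) :
    ∑ n ∈ Finset.range N, ((n : ℝ) + 1) ^ (-a) * ‖f (single p n)‖ ≤ M := by
  choose c hc hcf using fun n => Complex.exists_norm_le_one_mul_eq_norm (f (single p n))
  let x : ℕ → ℂ := fun n => ((((n : ℝ) + 1) ^ (-a) : ℝ) : ℂ) * c n
  have hx : x ∈ polydisc a 1 := fun n => by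
    rw [norm_mul, Complex.norm_real, Real.norm_of_nonneg (by positivity), mul_comm]
    exact mul_le_mul_of_nonneg_right (hc n) (by positivity)
  have hxN := ite_lt_mem_polydisc hx N
  have := hM (mk p _ (polydisc_subset p ha 1 hxN)) hxN
  rw [mk_ite_lt_eq_sum, map_sum] at this
  convert this
  rw [Complex.re_sum]
  refine Finset.sum_congr rfl fun n _ => ?_
  rw [map_smul, smul_eq_mul, mul_assoc, hcf, ← Complex.ofReal_mul, Complex.ofReal_re]

/-- All truncations of `x` stay in one polydisc, where coordinatewise convergence suffices. -/
theorem tendsto_sum_smul_single (x : DMinus p) :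
    Tendsto (fun N => ∑ n ∈ Finset.range N, toSeq p x n • single p n) atTop (𝓝 x) := by
  obtain ⟨a, ha, C, hx⟩ := exists_mem_polydisc p x
  have h : Tendsto (fun N => (⟨_, ite_lt_mem_polydisc hx N⟩ : polydisc a C)) atTop
      (𝓝 ⟨toSeq p x, hx⟩) := by
    refine tendsto_subtype_rng.2 (tendsto_pi_nhds.2 fun n => tendsto_const_nhds.congr' ?_)
    filter_upwards [eventually_gt_atTop n] with N hN
    exact (if_pos hN).symm
  have := ((continuous_mk_polydisc p ha C).tendsto _).comp h
  refine this.congr fun N => ?_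
  exact mk_ite_lt_eq_sum p _

variable {p}

theorem exists_mem_polydisc_of_tendsto (hlim : Tendsto u atTop (𝓝 p.toReal⁻¹)) (x : DMinus p) :
    ∃ k C, toSeq p x ∈ polydisc (u k) C := by
  obtain ⟨a, ha, C, hx⟩ := exists_mem_polydisc p x
  obtain ⟨k, hk⟩ := (hlim.eventually_lt_const ha).exists
  exact ⟨k, C, polydisc_subset_polydisc hk.le (nonneg_of_forall_norm_le hx) hx⟩

theorem continuous_echelon_of_bound {f : echelon u →ₗ[ℂ] ℂ} {k : ℕ} {C : ℝ}
    (hf : ∀ z, ‖f z‖ ≤ C * ‖z.1 k‖) : Continuous f := by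
  refine continuous_of_continuousAt_zero f ?_
  rw [ContinuousAt, map_zero]
  refine squeeze_zero_norm hf ?_
  have := ((echelon.continuous_apply (u := u) k).norm.const_mul C).tendsto 0
  simpa using this

/-- The linear functional on the echelon space given by an element of `d(p-)`. -/
def functional (hlim : Tendsto u atTop (𝓝 p.toReal⁻¹)) (x : DMinus p) : echelon u →ₗ[ℂ] ℂ where
  toFun z := ∑' n, toSeq p x n * coord n z
  map_add' y z := by
    obtain ⟨k, C, hx⟩ := exists_mem_polydisc_of_tendsto hlim x
    simp only [coord_add, mul_add]
    exact (summable_mul_coord hx y).tsum_add (summable_mul_coord hx z)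
  map_smul' c z := by
    simp only [coord_smul, mul_left_comm _ c, tsum_mul_left, RingHom.id_apply, smul_eq_mul]

/-- The pairing of `d(p-)` and the echelon space. -/
def pairing (hlim : Tendsto u atTop (𝓝 p.toReal⁻¹)) :
    DMinus p →ₗ[ℂ] StrongDual ℂ (echelon u) where
  toFun x := ⟨functional hlim x, by
    obtain ⟨k, C, hx⟩ := exists_mem_polydisc_of_tendsto hlim x
    exact continuous_echelon_of_bound (norm_tsum_mul_coord_le hx)⟩
  map_add' x y := by
    ext z
    obtain ⟨k, C, hx⟩ := exists_mem_polydisc_of_tendsto hlim x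
    obtain ⟨l, D, hy⟩ := exists_mem_polydisc_of_tendsto hlim y
    change ∑' n, toSeq p (x + y) n * coord n z = _
    simp only [map_add, Pi.add_apply, add_mul]
    exact (summable_mul_coord hx z).tsum_add (summable_mul_coord hy z)
  map_smul' c x := by
    ext z
    change ∑' n, toSeq p (c • x) n * coord n z = c * ∑' n, toSeq p x n * coord n z
    simp [mul_assoc, tsum_mul_left]

variable (hlim : Tendsto u atTop (𝓝 p.toReal⁻¹))

theorem pairing_apply (x : DMinus p) (z : echelon u) :
    pairing hlim x z = ∑' n, toSeq p x n * coord n z := rfl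

theorem pairing_single (n : ℕ) (z : echelon u) : pairing hlim (single p n) z = coord n z := by
  rw [pairing_apply, tsum_eq_single n fun m hm => ?_]
  · simp [single]
  · simp [single, hm]

theorem pairing_apply_single (x : DMinus p) (n : ℕ) :
    pairing hlim x (echelon.single u n) = toSeq p x n := by
  rw [pairing_apply, tsum_eq_single n fun m hm => ?_]
  · simp [coord_single]
  · simp [coord_single, hm]

theorem pairing_injective : Function.Injective (pairing (u := u) (p := p) hlim) := by
  intro x y h
  apply toSeq_injective
  funext n
  rw [← pairing_apply_single hlim, h, pairing_apply_single]

/-- A functional is determined by its values on the unit vectors; continuity for one seminorm `k`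
bounds these values by a multiple of `(n + 1) ^ (-u k)`. -/
theorem pairing_surjective (hu : Antitone u) (hpu : ∀ k, p.toReal⁻¹ < u k) :
    Function.Surjective (pairing (u := u) (p := p) hlim) := by
  intro g
  have hg : {z | ‖g z‖ < 1} ∈ 𝓝 (0 : echelon u) :=
    g.continuous.norm.continuousAt.eventually_lt_const (by simp)
  obtain ⟨k, δ, hδ, h⟩ := exists_ball_subset hu hg
  have hmem : (fun n => g (echelon.single u n)) ∈ polydisc (u k) (2 / δ) := by
    intro n
    have hw := rpow_neg_succ_pos (u k) n
    -- This factor scales the unit vector to seminorm `δ / 2`, inside the ball where `‖g z‖ < 1`.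
    have ht : 0 < δ / (2 * ((n : ℝ) + 1) ^ (-u k)) := by positivity
    have hmem : ‖((δ / (2 * ((n : ℝ) + 1) ^ (-u k)) : ℝ) : ℂ) • (echelon.single u n).1 k‖ < δ := by
      rw [norm_smul, Complex.norm_real, Real.norm_of_nonneg ht.le, norm_single_apply,
        div_mul_eq_mul_div, mul_div_mul_right _ _ hw.ne']
      exact half_lt_self hδ
    have hlt : ‖g (((δ / (2 * ((n : ℝ) + 1) ^ (-u k)) : ℝ) : ℂ) • echelon.single u n)‖ < 1 := h hmem
    rw [map_smul, norm_smul, Complex.norm_real, Real.norm_of_nonneg ht.le, div_mul_eq_mul_div,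
      div_lt_one (by positivity)] at hlt
    rw [div_mul_eq_mul_div, le_div_iff₀ hδ]
    linarith
  refine ⟨mk p _ (polydisc_subset p (hpu k) _ hmem), ?_⟩
  ext z
  have h1 := (hasSum_coord_smul_single z).mapL g
  rw [← h1.tsum_eq, pairing_apply]
  refine tsum_congr fun n => ?_
  rw [map_smul, smul_eq_mul, mul_comm, toSeq_mk]

theorem continuous_pairing (hu : Antitone u) : Continuous (pairing (u := u) (p := p) hlim) := by
  refine continuous_inductiveLimitTopology_dom (G := StrongDual ℂ (echelon u)) (ofStep p)
    (pairing hlim) fun q => ?_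
  refine LinearMap.continuous_strongDual_of_bound ((pairing hlim).comp (ofStep p q)) fun B hB => ?_
  have hq := inv_toReal_lt_inv_toReal (zero_lt_one.trans q.2.1) q.2.2
  obtain ⟨k, hk⟩ := (hlim.eventually_lt_const hq).exists
  obtain ⟨R, hR⟩ := (isVonNBounded_iff hu).1 hB k
  refine ⟨R, fun x z hz => ?_⟩
  have hxk : toSeq p (ofStep p q x) ∈ polydisc (u k) ‖x‖ :=
    polydisc_subset_polydisc hk.le (norm_nonneg x)
      (DSpace.norm_toSeq_le (toReal_pos_of_mem_Ioo q) x)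
  exact (norm_tsum_mul_coord_le hxk z).trans (mul_le_mul_of_nonneg_left (hR z hz) (norm_nonneg x))

/-- Every continuous linear functional on `d(p-)` is given by an element of the echelon space. -/
theorem exists_eq_pairing (hpu : ∀ k, p.toReal⁻¹ < u k) (f : StrongDual ℂ (DMinus p)) :
    ∃ z : echelon u, ∀ x, f x = pairing hlim x z := by
  have hsum : ∀ k, Summable fun n : ℕ => ((n : ℝ) + 1) ^ (-u k) * ‖f (single p n)‖ := by
    intro k
    -- Boundedness of `f` on compact polydiscs supplies the bound on the partial sums.
    obtain ⟨M, hM⟩ := (isCompact_preimage_polydisc p (hpu k) 1).exists_bound_of_continuousOn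
      f.continuous.continuousOn
    exact summable_of_sum_range_le (fun n => by positivity)
      (sum_norm_le p (f := f) (hpu k) fun x hx => (Complex.re_le_norm _).trans (hM x hx))
  refine ⟨echelon.mk _ hsum, fun x => ?_⟩
  obtain ⟨k, C, hx⟩ := exists_mem_polydisc_of_tendsto hlim x
  have h1 := (summable_mul_coord hx (echelon.mk _ hsum)).hasSum.tendsto_sum_nat
  have h2 := (f.continuous.tendsto x).comp (tendsto_sum_smul_single p x)
  refine tendsto_nhds_unique h2 (h1.congr fun N => ?_)
  simp [coord_mk]

/-- Bipolar argument: the polar `B` of a closed convex neighbourhood `U` is bounded because `U`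
absorbs the compact polydiscs, so the functionals bounded by `1` on `B` form a neighbourhood. `g`
maps it into `U`, since a separating functional, normalized, would come from `B`. -/
theorem continuous_symm_pairing (hu : Antitone u) (hpu : ∀ k, p.toReal⁻¹ < u k)
    (g : StrongDual ℂ (echelon u) →ₗ[ℂ] DMinus p) (hg : ∀ φ, pairing hlim (g φ) = φ) :
    Continuous g := by
  have := IsScalarTower.continuousSMul (M := ℝ) (α := DMinus p) ℂ
  refine continuous_of_continuousAt_zero g ?_
  rw [ContinuousAt, map_zero]
  refine (nhds_hasBasis_absConvex_closed ℝ (DMinus p)).tendsto_right_iff.2 ?_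
  rintro U ⟨hU, hUc, -, hUconv⟩
  let B : Set (echelon u) := {z | ∀ x ∈ U, (pairing hlim x z).re ≤ 1}
  have hB : Bornology.IsVonNBounded ℂ B := by
    refine (isVonNBounded_iff hu).2 fun k => ?_
    obtain ⟨R, hR, h⟩ := ((isCompact_preimage_polydisc p (hpu k) 1).isVonNBounded
      ℂ).exists_pos_forall_eq_smul hU
    refine ⟨R, fun z hz => le_of_tendsto' (echelon.hasSum_norm k z).tendsto_sum_nat fun N => ?_⟩
    let f : DMinus p →ₗ[ℂ] ℂ :=
      { toFun := fun x => pairing hlim x z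
        map_add' := fun x y => by simp
        map_smul' := fun c x => by simp }
    have hN := sum_norm_le p (f := f) (M := R) (hpu k) (fun x hx => ?_) N
    · simpa only [f, LinearMap.coe_mk, AddHom.coe_mk, pairing_single] using hN
    · obtain ⟨v, hv, rfl⟩ := h x hx
      rw [map_smul, smul_eq_mul, Complex.re_ofReal_mul]
      exact mul_le_of_le_one_right hR.le (hz v hv)
  filter_upwards [(ContinuousLinearMap.hasBasis_nhds_zero_of_basis
    Metric.nhds_basis_closedBall).mem_of_mem (i := (B, 1)) ⟨hB, one_pos⟩] with φ hφ
  by_contra hx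
  obtain ⟨f, c, hfU, hfx⟩ :=
    RCLike.geometric_hahn_banach_closed_point (𝕜 := ℂ) hUconv hUc hx
  have hc : 0 < c := by simpa using hfU 0 (mem_of_mem_nhds hU)
  obtain ⟨z, hz⟩ := exists_eq_pairing hlim hpu ((c : ℂ)⁻¹ • f)
  have hre : ∀ x, (pairing hlim x z).re = c⁻¹ * (f x).re := fun x => by
    rw [← hz, _root_.smul_apply, smul_eq_mul, ← Complex.ofReal_inv,
      Complex.re_ofReal_mul]
  have hzB : z ∈ B := fun x hx => by
    rw [hre, inv_mul_le_iff₀ hc, mul_one]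
    exact (hfU x hx).le
  have h1 := hφ z hzB
  rw [mem_closedBall_zero_iff] at h1
  have h2 := (Complex.re_le_norm _).trans h1
  rw [← hg φ, hre, inv_mul_le_iff₀ hc, mul_one] at h2
  exact absurd hfx h2.not_gt

variable (p) in
theorem isDFSSpace : IsDFSSpace (DMinus p) := by
  obtain ⟨u, hu, hpu, hlim⟩ := exists_seq_strictAnti_tendsto p.toReal⁻¹
  refine ⟨echelon u, inferInstance, inferInstance, inferInstance, isFrechetSpace,
    hasSchwartzProperty hu, ⟨?_⟩⟩
  let e : DMinus p ≃ₗ[ℂ] StrongDual ℂ (echelon u) := LinearEquiv.ofBijective (pairing hlim)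
    ⟨pairing_injective hlim, pairing_surjective hlim hu.antitone hpu⟩
  exact
    { e with
      continuous_toFun := continuous_pairing hlim hu.antitone
      continuous_invFun := continuous_symm_pairing hlim hu.antitone hpu e.symm
        fun φ => e.apply_symm_apply φ }

end DMinus

end Duality

/-! ### Comparison of the spaces -/

/-- The inclusion `d(q) ⊆ d(r)`, for `q ≤ r`. -/
def DSpace.inclusion {q r : ℝ≥0∞} (h : q ≤ r) : DSpace q →ₗ[ℂ] DSpace r :=
  Submodule.inclusion (dSubmodule_mono h)

theorem DSpace.continuous_inclusion {q r : ℝ≥0∞} [Fact (1 ≤ q)] [Fact (1 ≤ r)] (hqr : q < r)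
    (hr : r ≠ ∞) : Continuous (inclusion hqr.le) := by
  have hq0 : 0 < q := zero_lt_one.trans_le Fact.out
  have hq : 0 < q.toReal := ENNReal.toReal_pos hq0.ne' hqr.ne_top
  refine AddMonoidHomClass.continuous_of_bound (inclusion hqr.le)
    (powerNorm q.toReal⁻¹ r.toReal) fun x => ?_
  rw [mul_comm]
  refine DSpace.norm_le_of_forall_norm_le (inv_nonneg.2 hq.le) ?_ _ (DSpace.norm_toSeq_le hq x)
  rw [inv_mul_eq_div]
  exact (one_lt_div hq).2 ((ENNReal.toReal_lt_toReal hqr.ne_top hr).2 hqr)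

namespace DMinus

section Sequence

variable (p : ℝ≥0∞) [Fact (1 < p)] {s : ℕ → Set.Ioo 1 p}

theorem exists_mem_range_ofStep
    (hlim : Tendsto (fun k => (s k : ℝ≥0∞)) atTop (𝓝 p)) (x : DMinus p) :
    ∃ k, x ∈ LinearMap.range (ofStep p (s k)) := by
  obtain ⟨q, hq, hx⟩ := Set.mem_iUnion₂.1 (toSeq_mem p x)
  obtain ⟨k, hk⟩ := (hlim.eventually_const_lt hq.2).exists
  exact ⟨k, ⟨toSeq p x, dSubmodule_mono hk.le hx⟩, rfl⟩

theorem topology_eq_inductiveLimitTopology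
    (hlim : Tendsto (fun k => (s k : ℝ≥0∞)) atTop (𝓝 p)) :
    topology p = inductiveLimitTopology fun k => ofStep p (s k) := by
  refine le_antisymm ?_ ?_
  · obtain ⟨h₁, h₂, h₃, h₄⟩ := inductiveLimitTopology_spec fun k => ofStep p (s k)
    refine inductiveLimitTopology_le h₁ h₂ h₃ fun q => ?_
    obtain ⟨k, hk⟩ := (hlim.eventually_const_lt q.2.2).exists
    exact @Continuous.comp _ _ _ _ _ (_) (DSpace.inclusion hk.le) (ofStep p (s k)) (h₄ k)
      (DSpace.continuous_inclusion hk (s k).2.2.ne_top)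
  · exact inductiveLimitTopology_le inferInstance inferInstance inferInstance
      fun k => continuous_ofStep p (s k)

end Sequence

end DMinus

theorem dMinusSubmodule_mono {p q : ℝ≥0∞} [Fact (1 < p)] [Fact (1 < q)] (h : p ≤ q) :
    dMinusSubmodule p ≤ dMinusSubmodule q :=
  Set.biUnion_mono (Set.Ioo_subset_Ioo_right h) fun _ _ => subset_rfl

theorem dMinusSubmodule_strictMono {p q : ℝ≥0∞} [Fact (1 < p)] [Fact (1 < q)] (h : p < q) :
    dMinusSubmodule p < dMinusSubmodule q := by
  have hp : 0 < p := zero_lt_one.trans Fact.out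
  let x : ℕ → ℂ := fun n => ((((n : ℝ) + 1) ^ (-p.toReal⁻¹) : ℝ) : ℂ)
  have hx (n : ℕ) : ‖x n‖ = ((n : ℝ) + 1) ^ (-p.toReal⁻¹) := by
    rw [Complex.norm_real, Real.norm_of_nonneg (by positivity)]
  refine SetLike.lt_iff_le_and_exists.2 ⟨dMinusSubmodule_mono h.le, x, ?_, fun hmem => ?_⟩
  · exact (mem_dMinusSubmodule_iff q).2 ⟨p.toReal⁻¹, inv_toReal_lt_inv_toReal hp h, 1,
      fun n => by rw [hx, one_mul]⟩
  · obtain ⟨a, ha, C, hC⟩ := (mem_dMinusSubmodule_iff p).1 hmem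
    -- Membership in `d(p-)` would make this quotient of the bound by `‖x n‖` at least `1` for every
    -- `n`.
    have hlim : Tendsto (fun n : ℕ => C * ((n : ℝ) + 1) ^ (-(a - p.toReal⁻¹))) atTop (𝓝 0) := by
      simpa using (tendsto_rpow_neg_succ (sub_pos.2 ha)).const_mul C
    obtain ⟨n, hn⟩ := (hlim.eventually_lt_const one_pos).exists
    have h1 := hC n
    rw [hx, ← sub_add_cancel a p.toReal⁻¹, neg_add, Real.rpow_add (by positivity), ← mul_assoc]
      at h1
    have h2 := mul_lt_mul_of_pos_right hn (rpow_neg_succ_pos p.toReal⁻¹ n)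
    linarith

/-- The inclusion `d(p-) ⊆ d(q-)`, for `p ≤ q`. -/
def DMinus.inclusion {p q : ℝ≥0∞} [Fact (1 < p)] [Fact (1 < q)] (h : p ≤ q) :
    DMinus p →ₗ[ℂ] DMinus q :=
  Submodule.inclusion (dMinusSubmodule_mono h)

theorem DMinus.continuous_inclusion {p q : ℝ≥0∞} [Fact (1 < p)] [Fact (1 < q)] (h : p ≤ q) :
    Continuous (inclusion h) :=
  continuous_inductiveLimitTopology_dom (ofStep p) (inclusion h) fun r =>
    continuous_ofStep q ⟨r, r.2.1, r.2.2.trans_le h⟩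

end

theorem lemma4p2 :
    (∀ (p : ℝ≥0∞) [Fact (1 < p)],
      -- `d(p-)` is the (LB)-space `ind_k d(p_k)`, for any sequence `p_k ↑ p` in `(1, p)`
      (∀ q : Set.Ioo 1 p, CompleteSpace (DSpace q)) ∧
      (∀ s : ℕ → Set.Ioo 1 p, StrictMono s →
        Filter.Tendsto (fun k => (s k : ℝ≥0∞)) Filter.atTop (𝓝 p) →
        (∀ x : DMinus p, ∃ k, x ∈ LinearMap.range (DMinus.ofStep p (s k))) ∧
        DMinus.topology p = inductiveLimitTopology fun k => DMinus.ofStep p (s k)) ∧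
      -- `d(p-)` is a (DFS)-space and a Montel space
      IsDFSSpace (DMinus p) ∧
      IsMontelSpace (DMinus p)) ∧
    (∀ (p q : ℝ≥0∞) [Fact (1 < p)] [Fact (1 < q)], p ≤ q →
      -- `d(p-) ⊆ d(q-) ⊆ ℂ^ℕ` with continuous inclusions
      dMinusSubmodule p ≤ dMinusSubmodule q ∧
      (∃ i : DMinus p →L[ℂ] DMinus q, ∀ x, DMinus.toSeq q (i x) = DMinus.toSeq p x) ∧
      Continuous (DMinus.toSeq q) ∧
      -- the first inclusion is proper if `p < q`
      (p < q → dMinusSubmodule p < dMinusSubmodule q)) := by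
  refine ⟨fun p _ => ⟨fun q => DSpace.completeSpace (toReal_pos_of_mem_Ioo q), fun s _ hlim =>
    ⟨DMinus.exists_mem_range_ofStep p hlim, DMinus.topology_eq_inductiveLimitTopology p hlim⟩,
    DMinus.isDFSSpace p, DMinus.isMontelSpace p⟩, fun p q _ _ h => ?_⟩
  exact ⟨dMinusSubmodule_mono h, ⟨⟨DMinus.inclusion h, DMinus.continuous_inclusion h⟩,
    fun _ => rfl⟩, DMinus.continuous_toSeq q, dMinusSubmodule_strictMono⟩
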